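/- Let $E$ be a Polish space, that is, a separable completely metrizable topological space. Let $\mathcal{K}_E$ be the set of all compact countable subsets of $E$, where countable means finite or countably infinite (so $\varnothing\in\mathcal{K}_E$), and let $\mathscr{K}_E=\mathcal{K}_E/\!\sim$ be the set of its equivalence classes, where $K\sim L$ means that $K$ and $L$, with their subspace topologies, are homeomorphic. Let $|D|$ denote the cardinality of a set $D$. (i) If $E$ is finite, then $|\mathscr{K}_E|=|E|+1$. (ii) If $E$ is countably infinite, then $|\mathscr{K}_E|=|E|=\aleph_0$. (iii) If $E$ is uncountable, then $|\mathscr{K}_E|=\aleph_1$. -/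

import Mathlib

/-- The set `𝒦_E` of all compact countable (finite or countably infinite) subsets of `E`. -/
def CompactCountable (E : Type*) [TopologicalSpace E] : Type _ :=
  {K : Set E // IsCompact K ∧ K.Countable}

/-- Two compact countable subsets are equivalent if they are homeomorphic
for their subspace topologies. -/
def CompactCountable.homeoSetoid (E : Type*) [TopologicalSpace E] :
    Setoid (CompactCountable E) where
  r K L := Nonempty (K.1 ≃ₜ L.1)
  iseqv :=
    { refl := fun K => ⟨Homeomorph.refl K.1⟩
      symm := fun ⟨f⟩ => ⟨f.symm⟩
      trans := fun ⟨f⟩ ⟨g⟩ => ⟨f.trans g⟩ }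

/-- The set of homeomorphism classes of compact countable subsets of `E`. -/
def CompactCountableClasses (E : Type*) [TopologicalSpace E] : Type _ :=
  Quotient (CompactCountable.homeoSetoid E)

open Set Topology Filter TopologicalSpace
open scoped Ordinal

/-! A nonempty countable compact space has a last nonempty Cantor–Bendixson derivative, of countable
rank `α` and with a finite number `n` of points. The pair `(α, n)` is a complete homeomorphism
invariant (`SameCBType.nonempty_homeomorph`, by back and forth), so classes inject into ordinals
times `ℕ`. Upper bounds: ranks below `ω₁` give at most `ℵ₁` classes; if `E` is countable, its own
derivatives vanish at a countable stage, which bounds the ranks of all its subsets, so there are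
countably many classes. Lower bounds: an infinite `E` has finite subsets of every size; an
uncountable `E` contains a nonempty perfect set, near whose points compact countable sets of every
rank below `ω₁` are built, so countably many classes cannot suffice. For finite `E` everything is
discrete and only cardinality counts. -/

/-- The Cantor–Bendixson derivatives of a set `A`, relative to `A`. -/
def cbDeriv {X : Type*} [TopologicalSpace X] (A : Set X) (α : Ordinal.{0}) : Set X :=
  A ∩ ⋂ β : Set.Iio α, derivedSet (cbDeriv A β.1)
termination_by α
decreasing_by exact β.2

/-! ### Cantor–Bendixson derivatives and rank. -/

section CBDeriv

variable {X Y : Type*} [TopologicalSpace X] [TopologicalSpace Y]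

theorem mem_cbDeriv {A : Set X} {α : Ordinal.{0}} {x : X} :
    x ∈ cbDeriv A α ↔ x ∈ A ∧ ∀ β < α, x ∈ derivedSet (cbDeriv A β) := by
  rw [cbDeriv]
  simp

theorem cbDeriv_subset (A : Set X) (α : Ordinal.{0}) : cbDeriv A α ⊆ A :=
  fun _ hx => (mem_cbDeriv.1 hx).1

@[simp]
theorem cbDeriv_zero (A : Set X) : cbDeriv A 0 = A := by
  ext x
  simp [mem_cbDeriv]

theorem cbDeriv_antitone (A : Set X) : Antitone (cbDeriv A) := fun _ _ h _ hx =>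
  mem_cbDeriv.2 ⟨(mem_cbDeriv.1 hx).1, fun γ hγ => (mem_cbDeriv.1 hx).2 γ (hγ.trans_le h)⟩

theorem cbDeriv_subset_derivedSet (A : Set X) {α β : Ordinal.{0}} (h : β < α) :
    cbDeriv A α ⊆ derivedSet (cbDeriv A β) :=
  fun _ hx => (mem_cbDeriv.1 hx).2 β h

theorem isClosed_cbDeriv [T1Space X] {A : Set X} (hA : IsClosed A) (α : Ordinal.{0}) :
    IsClosed (cbDeriv A α) := by
  rw [cbDeriv]
  exact hA.inter (isClosed_iInter fun _ => isClosed_derivedSet _)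

/-- Injectivity keeps the images of accumulating points distinct from the image of their limit. This
yields both monotonicity in the set and topological invariance. -/
theorem mapsTo_cbDeriv {f : X → Y} {A : Set X} {B : Set Y} (hAB : MapsTo f A B)
    (hc : ContinuousOn f A) (hi : InjOn f A) (α : Ordinal.{0}) :
    MapsTo f (cbDeriv A α) (cbDeriv B α) := by
  induction α using WellFoundedLT.induction with
  | ind α ih =>
    intro x hx
    have hxA := cbDeriv_subset A α hx
    refine mem_cbDeriv.2 ⟨hAB hxA, fun β hβ => ?_⟩
    rw [mem_derivedSet, accPt_iff_nhds]
    intro U hU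
    obtain ⟨V, hV, hVU⟩ := mem_nhdsWithin_iff_exists_mem_nhds_inter.1 (hc x hxA hU)
    obtain ⟨y, ⟨hyV, hy⟩, hne⟩ := accPt_iff_nhds.1 (cbDeriv_subset_derivedSet A hβ hx) V hV
    have hyA := cbDeriv_subset A β hy
    exact ⟨f y, ⟨hVU ⟨hyV, hyA⟩, ih β hβ hy⟩, fun h => hne (hi hyA hxA h)⟩

theorem cbDeriv_mono {A B : Set X} (h : A ⊆ B) (α : Ordinal.{0}) : cbDeriv A α ⊆ cbDeriv B α :=
  mapsTo_cbDeriv (f := id) h continuousOn_id (injOn_id _) α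

theorem Perfect.eq_empty_of_countable [PolishSpace X] {P : Set X} (hP : Perfect P)
    (hc : P.Countable) : P = ∅ := by
  by_contra hne
  let _ := upgradeIsCompletelyMetrizable X
  obtain ⟨f, hf, -, hinj⟩ := hP.exists_nat_bool_injection (nonempty_iff_ne_empty.2 hne)
  have h : (univ : Set (ℕ → Bool)).Countable :=
    MapsTo.countable_of_injOn (f := f) (fun x _ => hf (mem_range_self x)) hinj.injOn hc
  have h' := Cardinal.mk_le_aleph0_iff.2 (countable_univ_iff.1 h)
  simp only [Cardinal.mk_pi, Cardinal.mk_bool, Cardinal.prod_const, Cardinal.mk_nat,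
    Cardinal.lift_id, Cardinal.two_power_aleph0] at h'
  exact not_le.2 Cardinal.aleph0_lt_continuum h'

/-- The isolated points of a countable closed subset of a Polish space are dense in it. -/
theorem IsClosed.exists_notMem_derivedSet [PolishSpace X] {P U : Set X} (hP : IsClosed P)
    (hc : P.Countable) (hU : IsOpen U) (hne : (U ∩ P).Nonempty) :
    ∃ q ∈ U ∩ P, q ∉ derivedSet P := by
  by_contra! h
  have hpre : Preperfect (U ∩ P) := fun x hx => (h x hx).nhds_inter (hU.mem_nhds hx.1)
  have hsub : closure (U ∩ P) ⊆ P := closure_minimal inter_subset_right hP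
  have := hpre.perfect_closure.eq_empty_of_countable (hc.mono hsub)
  exact (hne.mono subset_closure).ne_empty this

/-- Deleting finitely many isolated points from `U` leaves an open neighbourhood of `p`, which by
density contains a further one. -/
theorem IsClosed.infinite_isolated [PolishSpace X] {P U : Set X} (hP : IsClosed P)
    (hc : P.Countable) (hU : IsOpen U) {p : X} (hpU : p ∈ U) (hp : p ∈ derivedSet P) :
    ((U ∩ P) \ derivedSet P).Infinite := by
  intro hfin
  have hV : IsOpen (U \ ((U ∩ P) \ derivedSet P)) := hU.sdiff hfin.isClosed
  have hpV : p ∈ U \ ((U ∩ P) \ derivedSet P) := ⟨hpU, fun h => h.2 hp⟩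
  obtain ⟨y, hy, -⟩ := accPt_iff_nhds.1 hp _ (hV.mem_nhds hpV)
  obtain ⟨q, hq, hq'⟩ := hP.exists_notMem_derivedSet hc hV ⟨y, hy⟩
  exact hq.1.2 ⟨⟨hq.1.1, hq.2⟩, hq'⟩

theorem mk_Iio_omega_one : Cardinal.mk (Iio (ω₁ : Ordinal.{0})) = Cardinal.aleph 1 := by
  rw [Cardinal.mk_Iio_ordinal]
  simp

theorem countable_Iio_of_lt_omega_one {α : Ordinal.{0}} (h : α < ω₁) : (Iio α).Countable := by
  rw [← Cardinal.le_aleph0_iff_set_countable, Cardinal.mk_Iio_ordinal,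
    Cardinal.lift_le_aleph0]
  exact Cardinal.lt_aleph_one_iff.1 (Cardinal.lt_omega_iff_card_lt.1 h)

/-- Otherwise pick an isolated point of each stage below `ω₁`. It is lost at all later stages, so
these are `ℵ₁` distinct points of `A`. -/
theorem IsClosed.exists_cbDeriv_eq_empty [PolishSpace X] {A : Set X} (hA : IsClosed A)
    (hc : A.Countable) : ∃ α < (ω₁ : Ordinal.{0}), cbDeriv A α = ∅ := by
  by_contra! h
  have key : ∀ α : Iio (ω₁ : Ordinal.{0}), ∃ q ∈ cbDeriv A α, q ∉ derivedSet (cbDeriv A α) := by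
    intro α
    simpa using (isClosed_cbDeriv hA α).exists_notMem_derivedSet (hc.mono (cbDeriv_subset A _)) isOpen_univ
      (by simpa using h α α.2)
  choose g hg hg' using key
  have hlt : ∀ α β, α < β → g α ≠ g β := fun α β hαβ heq =>
    hg' α (heq ▸ cbDeriv_subset_derivedSet A hαβ (hg β))
  have hinj : Function.Injective g := fun α β heq => by
    rcases lt_trichotomy α β with hl | hl | hl
    · exact absurd heq (hlt _ _ hl)
    · exact hl
    · exact absurd heq.symm (hlt _ _ hl)
  have : (univ : Set (Iio (ω₁ : Ordinal.{0}))).Countable :=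
    MapsTo.countable_of_injOn (f := g) (fun α _ => cbDeriv_subset A _ (hg α)) hinj.injOn hc
  have hle := Cardinal.mk_le_aleph0_iff.2 (countable_univ_iff.1 this)
  rw [mk_Iio_omega_one] at hle
  exact absurd hle (not_le.2 Cardinal.aleph0_lt_aleph_one)

/-- A nonempty closed subset of a compact space with vanishing derivative has a last nonempty
derivative, which is finite. -/
theorem IsClosed.exists_encard_inter_cbDeriv [CompactSpace X] [T1Space X] {B : Set X}
    (hB : IsClosed B) (hne : B.Nonempty) {γ : Ordinal.{0}} (hγ : cbDeriv (univ : Set X) γ = ∅) :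
    ∃ α < γ, ∃ n : ℕ, n ≠ 0 ∧ (B ∩ cbDeriv univ α).encard = n := by
  classical
  obtain ⟨α₀, hα₀, hmin⟩ := WellFounded.has_min (wellFounded_lt (α := Ordinal.{0}))
    {α | B ∩ cbDeriv univ α = ∅} ⟨γ, by simp [hγ]⟩
  have hα₀γ : α₀ ≤ γ := not_lt.1 (hmin γ (by simp [hγ]))
  have hpos : α₀ ≠ 0 := by
    rintro rfl
    simp only [mem_ofPred_eq, cbDeriv_zero, inter_univ] at hα₀
    exact hne.ne_empty hα₀
  have hcl : ∀ β, IsClosed (B ∩ derivedSet (cbDeriv (univ : Set X) β)) :=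
    fun β => hB.inter (isClosed_derivedSet _)
  -- Compactness at the first stage `α₀` missing `B` replaces a successor/limit case split. An
  -- infinite `B ∩ cbDeriv univ β` would then accumulate inside an empty set.
  obtain ⟨β, hβ, hempty⟩ : ∃ β < α₀, B ∩ derivedSet (cbDeriv univ β) = ∅ := by
    by_contra! h
    have : Nonempty (Iio α₀) := ⟨⟨0, pos_iff_ne_zero.2 hpos⟩⟩
    obtain ⟨x, hx⟩ := IsCompact.nonempty_iInter_of_directed_nonempty_isCompact_isClosed
      (fun β : Iio α₀ => B ∩ derivedSet (cbDeriv univ β.1))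
      (Antitone.directed_ge fun β β' hle => inter_subset_inter_right _
        (derivedSet_mono _ _ (cbDeriv_antitone _ hle)))
      (fun β => h β β.2) (fun β => (hcl β).isCompact) (fun β => hcl β)
    rw [mem_iInter] at hx
    have : x ∈ B ∩ cbDeriv univ α₀ :=
      ⟨(hx (Classical.arbitrary _)).1, mem_cbDeriv.2 ⟨trivial, fun β hβ => (hx ⟨β, hβ⟩).2⟩⟩
    rw [hα₀] at this
    exact this
  have hfin : (B ∩ cbDeriv univ β).Finite := by
    by_contra hinf
    obtain ⟨x, hxB, hx⟩ := Set.Infinite.exists_accPt_of_subset_isCompact hinf hB.isCompact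
      inter_subset_left
    have : x ∈ B ∩ derivedSet (cbDeriv univ β) :=
      ⟨hxB, derivedSet_mono _ _ inter_subset_right hx⟩
    rw [hempty] at this
    exact this
  have hne' : (B ∩ cbDeriv univ β).Nonempty := nonempty_iff_ne_empty.2 fun h => hmin β h hβ
  refine ⟨β, hβ.trans_le hα₀γ, (B ∩ cbDeriv univ β).ncard, ?_, hfin.cast_ncard_eq.symm⟩
  exact ((ncard_pos hfin).2 hne').ne'

end CBDeriv

/-! ### Back and forth with clopen partitions. -/

section BackAndForth

variable {X Y : Type*} [TopologicalSpace X] [TopologicalSpace Y]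

/-- Every clopen splitting of the first set is matched by a clopen splitting of the second. -/
def ClopenSplits (R : Set X → Set Y → Prop) : Prop :=
  ∀ A B U, IsClopen A → IsClopen B → R A B → IsClopen U → U ⊆ A →
    ∃ V, IsClopen V ∧ V ⊆ B ∧ R U V ∧ R (A \ U) (B \ V)

/-- Two continuous colourings whose colour classes are related by `R`. -/
def RelatedColorings (R : Set X → Set Y → Prop) (f : X → ℕ) (g : Y → ℕ) : Prop :=
  Continuous f ∧ Continuous g ∧ ∀ i, R (f ⁻¹' {i}) (g ⁻¹' {i})

theorem RelatedColorings.swap {R : Set X → Set Y → Prop} {f : X → ℕ} {g : Y → ℕ}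
    (h : RelatedColorings R f g) : RelatedColorings (fun B A => R A B) g f :=
  ⟨h.2.1, h.1, h.2.2⟩

theorem continuous_of_isClopen_preimage_even_odd {f : X → ℕ}
    (he : ∀ i, IsClopen (f ⁻¹' {2 * i})) (ho : ∀ i, IsClopen (f ⁻¹' {2 * i + 1})) :
    Continuous f := by
  refine continuous_discrete_rng.2 fun j => ?_
  rcases Nat.even_or_odd' j with ⟨i, rfl | rfl⟩
  exacts [(he i).isOpen, (ho i).isOpen]

/-- Colour `i` splits into `2 * i + 1` on `U` (on the matching `V i` in `Y`) and `2 * i` off it;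
halving recovers the old colour. -/
theorem RelatedColorings.refine_left {R : Set X → Set Y → Prop} (hR : ClopenSplits R)
    {f : X → ℕ} {g : Y → ℕ} (h : RelatedColorings R f g) {U : Set X} (hU : IsClopen U) :
    ∃ f' g', RelatedColorings R f' g' ∧ (∃ π : ℕ → ℕ, f = π ∘ f' ∧ g = π ∘ g') ∧
      ∀ x y, f' x = f' y → x ∈ U → y ∈ U := by
  classical
  obtain ⟨hf, hg, hfg⟩ := h
  have hfc : ∀ i, IsClopen (f ⁻¹' {i}) := fun i => (isClopen_discrete {i}).preimage hf
  have hgc : ∀ i, IsClopen (g ⁻¹' {i}) := fun i => (isClopen_discrete {i}).preimage hg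
  choose V hV hVsub hRV hRV' using fun i => hR _ _ (f ⁻¹' {i} ∩ U) (hfc i) (hgc i) (hfg i)
    ((hfc i).inter hU) inter_subset_left
  let f' : X → ℕ := fun x => 2 * f x + if x ∈ U then 1 else 0
  let g' : Y → ℕ := fun y => 2 * g y + if y ∈ V (g y) then 1 else 0
  have hfo : ∀ i, f' ⁻¹' {2 * i + 1} = f ⁻¹' {i} ∩ U := by
    intro i
    ext x
    by_cases hx : x ∈ U <;> simp [f', hx]
    omega
  have hfe : ∀ i, f' ⁻¹' {2 * i} = f ⁻¹' {i} \ (f ⁻¹' {i} ∩ U) := by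
    intro i
    ext x
    by_cases hx : x ∈ U <;> simp [f', hx]
    omega
  have hgo : ∀ i, g' ⁻¹' {2 * i + 1} = V i := by
    intro i
    ext y
    have key : y ∈ V i → g y = i := fun hy => hVsub i hy
    by_cases hy : y ∈ V (g y)
    · simp only [g', hy, mem_preimage, mem_singleton_iff, if_true]
      refine ⟨fun h => ?_, fun h => by rw [key h]⟩
      have : g y = i := by omega
      exact this ▸ hy
    · simp only [g', hy, mem_preimage, mem_singleton_iff, if_false]
      refine ⟨fun h => by omega, fun h => absurd ?_ hy⟩
      rwa [key h]
  have hge : ∀ i, g' ⁻¹' {2 * i} = g ⁻¹' {i} \ V i := by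
    intro i
    ext y
    by_cases hy : y ∈ V (g y)
    · simp only [g', hy, mem_preimage, mem_singleton_iff, if_true, Set.mem_sdiff]
      refine ⟨fun h => by omega, fun h => absurd ?_ h.2⟩
      rwa [← h.1]
    · simp only [g', hy, mem_preimage, mem_singleton_iff, if_false, Set.mem_sdiff]
      refine ⟨fun h => ?_, fun h => by omega⟩
      have : g y = i := by omega
      exact ⟨this, this ▸ hy⟩
  refine ⟨f', g', ⟨?_, ?_, ?_⟩, ⟨fun n => n / 2, ?_, ?_⟩, ?_⟩
  · refine continuous_of_isClopen_preimage_even_odd (fun i => ?_) fun i => ?_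
    · rw [hfe]
      exact (hfc i).diff ((hfc i).inter hU)
    · rw [hfo]
      exact (hfc i).inter hU
  · refine continuous_of_isClopen_preimage_even_odd (fun i => ?_) fun i => ?_
    · rw [hge]
      exact (hgc i).diff (hV i)
    · rw [hgo]
      exact hV i
  · intro j
    rcases Nat.even_or_odd' j with ⟨i, rfl | rfl⟩
    · rw [hfe, hge]
      exact hRV' i
    · rw [hfo, hgo]
      exact hRV i
  · funext x
    simp only [f', Function.comp]
    split_ifs <;> omega
  · funext y
    simp only [g', Function.comp]
    split_ifs <;> omega
  · intro x y hxy hx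
    by_contra hy
    simp only [f', hx, hy, if_true, if_false] at hxy
    omega

theorem RelatedColorings.refine {R : Set X → Set Y → Prop} (hR : ClopenSplits R)
    (hR' : ClopenSplits fun B A => R A B) {f : X → ℕ} {g : Y → ℕ} (h : RelatedColorings R f g)
    {U : Set X} (hU : IsClopen U) {W : Set Y} (hW : IsClopen W) :
    ∃ f' g', RelatedColorings R f' g' ∧ (∃ π : ℕ → ℕ, f = π ∘ f' ∧ g = π ∘ g') ∧
      (∀ x y, f' x = f' y → x ∈ U → y ∈ U) ∧ ∀ x y, g' x = g' y → x ∈ W → y ∈ W := by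
  obtain ⟨f₁, g₁, h₁, ⟨π₁, hf₁, hg₁⟩, hsep₁⟩ := h.refine_left hR hU
  obtain ⟨g₂, f₂, h₂, ⟨π₂, hg₂, hf₂⟩, hsep₂⟩ := h₁.swap.refine_left hR' hW
  refine ⟨f₂, g₂, h₂.swap, ⟨π₁ ∘ π₂, ?_, ?_⟩, fun x y hxy => hsep₁ x y ?_, hsep₂⟩
  · rw [hf₁, hf₂]; rfl
  · rw [hg₁, hg₂]; rfl
  · rw [hf₂, Function.comp, hxy]; rfl

theorem exists_seq_isClopen_separating [TotallySeparatedSpace X] [Countable X] :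
    ∃ U : ℕ → Set X, (∀ n, IsClopen (U n)) ∧ ∀ x y, x ≠ y → ∃ n, x ∈ U n ∧ y ∉ U n := by
  have key : ∀ p : X × X, ∃ U : Set X, IsClopen U ∧ (p.1 ≠ p.2 → p.1 ∈ U ∧ p.2 ∉ U) := by
    intro p
    by_cases hp : p.1 = p.2
    · exact ⟨univ, isClopen_univ, fun h => absurd hp h⟩
    · obtain ⟨U, hU, h₁, h₂⟩ := exists_isClopen_of_totally_separated hp
      exact ⟨U, hU, fun _ => ⟨h₁, h₂⟩⟩
  choose U hU hsep using key
  cases isEmpty_or_nonempty X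
  · exact ⟨fun _ => univ, fun _ => isClopen_univ, fun x => isEmptyElim x⟩
  · obtain ⟨e, he⟩ := exists_surjective_nat (X × X)
    refine ⟨fun n => U (e n), fun n => hU _, fun x y hxy => ?_⟩
    obtain ⟨n, hn⟩ := he (x, y)
    exact ⟨n, by simpa [hn] using hsep (x, y) hxy⟩

/-- The classes in `Y` with the colours of `x` are nested, closed and nonempty, so they share a
point by compactness. -/
theorem range_subset_range_of_colorings [CompactSpace Y] {R : Set X → Set Y → Prop}
    (hempty : ∀ A B, R A B → A.Nonempty → B.Nonempty) {f : ℕ → X → ℕ} {g : ℕ → Y → ℕ}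
    (h : ∀ n, RelatedColorings R (f n) (g n))
    (hπ : ∀ n, ∃ π : ℕ → ℕ, f n = π ∘ f (n + 1) ∧ g n = π ∘ g (n + 1)) :
    range (fun x n => f n x) ⊆ range (fun y n => g n y) := by
  rintro _ ⟨x, rfl⟩
  have hcl : ∀ n, IsClosed (g n ⁻¹' {f n x}) :=
    fun n => (isClosed_discrete _).preimage (h n).2.1
  have hanti : ∀ n, g (n + 1) ⁻¹' {f (n + 1) x} ⊆ g n ⁻¹' {f n x} := by
    intro n y hy
    obtain ⟨π, hf, hg⟩ := hπ n
    have hy' : g (n + 1) y = f (n + 1) x := hy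
    simp [hf, hg, hy']
  obtain ⟨y, hy⟩ := IsCompact.nonempty_iInter_of_sequence_nonempty_isCompact_isClosed
    (fun n => g n ⁻¹' {f n x}) hanti
    (fun n => hempty _ _ ((h n).2.2 (f n x)) ⟨x, rfl⟩) (hcl 0).isCompact hcl
  exact ⟨y, funext fun n => mem_iInter.1 hy n⟩

/-- Back and forth: a relation between clopen sets that is preserved by splitting on both sides
and only relates the empty set to itself yields a homeomorphism. -/
theorem nonempty_homeomorph_of_clopenSplits [CompactSpace X] [CompactSpace Y]
    [TotallySeparatedSpace X] [TotallySeparatedSpace Y] [Countable X] [Countable Y]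
    {R : Set X → Set Y → Prop} (hempty : ∀ A B, R A B → (A.Nonempty ↔ B.Nonempty))
    (hR : ClopenSplits R) (hR' : ClopenSplits fun B A => R A B) (h0 : R ∅ ∅)
    (h1 : R univ univ) : Nonempty (X ≃ₜ Y) := by
  obtain ⟨U, hU, hUsep⟩ := exists_seq_isClopen_separating (X := X)
  obtain ⟨W, hW, hWsep⟩ := exists_seq_isClopen_separating (X := Y)
  let C := {p : (X → ℕ) × (Y → ℕ) // RelatedColorings R p.1 p.2}
  have hstep : ∀ (n : ℕ) (c : C), ∃ c' : C,
      (∃ π : ℕ → ℕ, c.1.1 = π ∘ c'.1.1 ∧ c.1.2 = π ∘ c'.1.2) ∧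
      (∀ x y, c'.1.1 x = c'.1.1 y → x ∈ U n → y ∈ U n) ∧
      ∀ x y, c'.1.2 x = c'.1.2 y → x ∈ W n → y ∈ W n := by
    intro n c
    obtain ⟨f', g', h, h'⟩ := c.2.refine hR hR' (hU n) (hW n)
    exact ⟨⟨(f', g'), h⟩, h'⟩
  choose step hπ hsepX hsepY using hstep
  have hinit : RelatedColorings R (fun _ : X => 0) (fun _ : Y => 0) := by
    refine ⟨continuous_const, continuous_const, fun i => ?_⟩
    by_cases hi : (0 : ℕ) ∈ ({i} : Set ℕ)
    · rwa [preimage_const_of_mem hi, preimage_const_of_mem hi]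
    · rwa [preimage_const_of_notMem hi, preimage_const_of_notMem hi]
  let c : ℕ → C := fun n => Nat.rec ⟨(fun _ => 0, fun _ => 0), hinit⟩ step n
  have hc : ∀ n, c (n + 1) = step n (c n) := fun n => rfl
  -- The colour sequences embed `X` and `Y` in `ℕ → ℕ` with the same image.
  let F : X → ℕ → ℕ := fun x n => (c n).1.1 x
  let G : Y → ℕ → ℕ := fun y n => (c n).1.2 y
  have hF : Continuous F := continuous_pi fun n => (c n).2.1
  have hG : Continuous G := continuous_pi fun n => (c n).2.2.1
  have hFinj : Function.Injective F := fun x y hxy => by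
    by_contra hne
    obtain ⟨n, hx, hy⟩ := hUsep x y hne
    exact hy (hsepX n (c n) x y (congrFun hxy (n + 1)) hx)
  have hGinj : Function.Injective G := fun x y hxy => by
    by_contra hne
    obtain ⟨n, hx, hy⟩ := hWsep x y hne
    exact hy (hsepY n (c n) x y (congrFun hxy (n + 1)) hx)
  have hrange : range F = range G := by
    apply Subset.antisymm
    · exact range_subset_range_of_colorings (R := R) (fun A B h => (hempty A B h).1)
        (f := fun n => (c n).1.1) (g := fun n => (c n).1.2) (fun n => (c n).2)
        (fun n => hπ n (c n))
    · exact range_subset_range_of_colorings (R := fun B A => R A B)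
        (fun A B h => (hempty B A h).2)
        (f := fun n => (c n).1.2) (g := fun n => (c n).1.1) (fun n => (c n).2.swap)
        (fun n => (hπ n (c n)).imp fun _ h => h.symm)
  have eF := (hF.isClosedEmbedding hFinj).isEmbedding.toHomeomorph
  have eG := (hG.isClosedEmbedding hGinj).isEmbedding.toHomeomorph
  exact ⟨(eF.trans (Homeomorph.setCongr hrange)).trans eG.symm⟩

end BackAndForth

/-! ### Classification by rank and number of top points. -/

section Classification

theorem encard_inter_add_encard_sdiff_inter {Z : Type*} {S T D : Set Z} (hTS : T ⊆ S) :
    (T ∩ D).encard + ((S \ T) ∩ D).encard = (S ∩ D).encard := by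
  rw [← encard_union_eq, ← union_inter_distrib_right, union_sdiff_cancel hTS]
  exact disjoint_sdiff_right.mono inter_subset_left inter_subset_left

variable {X Y : Type*} [TopologicalSpace X] [TopologicalSpace Y]

theorem IsClopen.exists_isClopen_inter_eq [CompactSpace X] [T2Space X] [TotallyDisconnectedSpace X]
    {B P T : Set X} (hB : IsClopen B) (hT : IsClosed T) (hTsub : T ⊆ B ∩ P)
    (hPT : IsClosed (P \ T)) : ∃ C, IsClopen C ∧ C ⊆ B ∧ C ∩ P = T := by
  obtain ⟨C, hC, hTC, hCU⟩ := exists_clopen_of_closed_subset_open hT (hB.isOpen.sdiff hPT)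
    (fun x hx => ⟨(hTsub hx).1, fun h => h.2 hx⟩)
  refine ⟨C, hC, fun x hx => (hCU hx).1, Subset.antisymm (fun x hx => ?_)
    fun x hx => ⟨hTC hx, (hTsub hx).2⟩⟩
  by_contra hxT
  exact (hCU hx.1).2 ⟨hx.2, hxT⟩

theorem IsClopen.exists_isClopen_encard_inter_eq [CompactSpace X] [T2Space X]
    [TotallyDisconnectedSpace X] {B P : Set X} (hB : IsClopen B) {n k : ℕ}
    (hn : (B ∩ P).encard = n) (hk : k ≤ n) :
    ∃ C, IsClopen C ∧ C ⊆ B ∧ (C ∩ P).encard = k := by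
  have hfin : (B ∩ P).Finite := finite_of_encard_eq_coe hn
  obtain ⟨T, hT, hTk⟩ := exists_subset_encard_eq (s := B ∩ P) (k := k) (by rw [hn]; exact_mod_cast hk)
  obtain ⟨C, hC, hCB, hCP⟩ := hB.exists_isClopen_inter_eq (P := B ∩ P)
    (hfin.subset hT).isClosed (fun x hx => ⟨(hT hx).1, hT hx⟩) (hfin.subset sdiff_subset).isClosed
  refine ⟨C, hC, hCB, ?_⟩
  rw [← inter_eq_left.2 hCB, inter_assoc, hCP, hTk]

/-- Near a point of stage `α` there are infinitely many isolated points of stage `β`. A clopen set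
meeting stage `β` in just `m` of them misses stage `α`. -/
theorem IsClopen.exists_isClopen_encard_cbDeriv [CompactSpace X] [PolishSpace X] [Countable X]
    {B : Set X} (hB : IsClopen B) {α β : Ordinal.{0}} (hβ : β < α)
    (hne : (B ∩ cbDeriv univ α).Nonempty) (m : ℕ) :
    ∃ C, IsClopen C ∧ C ⊆ B ∧ (C ∩ cbDeriv univ β).encard = m ∧ C ∩ cbDeriv univ α = ∅ := by
  obtain ⟨p, hpB, hp⟩ := hne
  have hP : IsClosed (cbDeriv (univ : Set X) β) := isClosed_cbDeriv isClosed_univ β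
  have hinf := hP.infinite_isolated (to_countable _) hB.isOpen hpB
    (cbDeriv_subset_derivedSet _ hβ hp)
  obtain ⟨T, hT, hTm⟩ := exists_subset_encard_eq (k := (m : ℕ∞)) (by rw [hinf.encard_eq]; exact le_top)
  have hTfin : T.Finite := finite_of_encard_eq_coe hTm
  have hPT : IsClosed (cbDeriv univ β \ T) := by
    rw [isClosed_iff_derivedSet_subset]
    intro x hx
    have hx' := derivedSet_mono _ _ sdiff_subset hx
    exact ⟨(isClosed_iff_derivedSet_subset _).1 hP hx', fun hxT => (hT hxT).2 hx'⟩
  obtain ⟨C, hC, hCB, hCP⟩ := hB.exists_isClopen_inter_eq hTfin.isClosed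
    (fun x hx => (hT hx).1) hPT
  refine ⟨C, hC, hCB, by rw [hCP, hTm], eq_empty_iff_forall_notMem.2 fun x hx => ?_⟩
  have hxT : x ∈ T := hCP ▸ ⟨hx.1, cbDeriv_antitone _ hβ.le hx.2⟩
  exact (hT hxT).2 (cbDeriv_subset_derivedSet _ hβ hx.2)

/-- Two sets are either both empty, or have the same Cantor–Bendixson rank and the same finite
number of points of maximal rank. -/
def SameCBType (A : Set X) (B : Set Y) : Prop :=
  A = ∅ ∧ B = ∅ ∨ ∃ (α : Ordinal.{0}) (n : ℕ), n ≠ 0 ∧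
    (A ∩ cbDeriv univ α).encard = n ∧ (B ∩ cbDeriv univ α).encard = n

theorem SameCBType.symm {A : Set X} {B : Set Y} (h : SameCBType A B) : SameCBType B A :=
  h.imp And.symm fun ⟨α, n, hn, hA, hB⟩ => ⟨α, n, hn, hB, hA⟩

theorem SameCBType.nonempty {A : Set X} {B : Set Y} (h : SameCBType A B) (hA : A.Nonempty) :
    B.Nonempty := by
  rcases h with ⟨rfl, -⟩ | ⟨α, n, hn, -, hB⟩
  · exact absurd hA not_nonempty_empty
  · refine (nonempty_iff_ne_empty.2 fun h => hn ?_ : (B ∩ cbDeriv univ α).Nonempty).mono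
      inter_subset_left
    rw [h, encard_empty] at hB
    exact_mod_cast hB.symm

variable [CompactSpace X] [PolishSpace X] [Countable X] [CompactSpace Y] [PolishSpace Y]
  [Countable Y]

theorem exists_sameCBType_of_inter_cbDeriv_eq_empty {U : Set X} {B : Set Y} (hU : IsClopen U)
    (hB : IsClopen B) {α : Ordinal.{0}} (hUα : U ∩ cbDeriv univ α = ∅)
    (hBα : (B ∩ cbDeriv univ α).Nonempty) :
    ∃ V, IsClopen V ∧ V ⊆ B ∧ SameCBType U V ∧ V ∩ cbDeriv univ α = ∅ := by
  rcases U.eq_empty_or_nonempty with rfl | hne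
  · exact ⟨∅, isClopen_empty, empty_subset _, Or.inl ⟨rfl, rfl⟩, empty_inter _⟩
  obtain ⟨γ, -, hγ⟩ := (isClosed_univ (X := X)).exists_cbDeriv_eq_empty (to_countable _)
  obtain ⟨β, -, m, hm, hUβ⟩ := hU.isClosed.exists_encard_inter_cbDeriv hne hγ
  have hβα : β < α := by
    by_contra! hle
    have : U ∩ cbDeriv univ β = ∅ :=
      subset_empty_iff.1 (hUα ▸ inter_subset_inter_right U (cbDeriv_antitone univ hle))
    rw [this, encard_empty] at hUβ
    exact hm (by exact_mod_cast hUβ.symm)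
  obtain ⟨V, hV, hVB, hVβ, hVα⟩ := hB.exists_isClopen_encard_cbDeriv hβα hBα m
  exact ⟨V, hV, hVB, Or.inr ⟨β, m, hm, hUβ, hVβ⟩, hVα⟩

/-- The `n` top points split as `k + l`. If both are positive, separate `k` top points of `B`. If
one is zero, that piece has lower rank: a copy is carved out of `B` and the complement keeps all `n`
top points. -/
theorem clopenSplits_sameCBType : ClopenSplits (SameCBType : Set X → Set Y → Prop) := by
  rintro A B U hA hB (⟨rfl, rfl⟩ | ⟨α, n, hn, hAn, hBn⟩) hU hUA
  · obtain rfl := subset_empty_iff.1 hUA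
    exact ⟨∅, isClopen_empty, Subset.rfl, Or.inl ⟨rfl, rfl⟩,
      Or.inl ⟨Set.sdiff_self, Set.sdiff_self⟩⟩
  have hBne : (B ∩ cbDeriv univ α).Nonempty := by
    rw [← encard_pos, hBn]
    exact_mod_cast Nat.pos_of_ne_zero hn
  have hAfin := finite_of_encard_eq_coe hAn
  have hU' : IsClopen (A \ U) := hA.diff hU
  obtain ⟨k, hk⟩ := (hAfin.subset (inter_subset_inter_left _ hUA)).exists_encard_eq_coe
  obtain ⟨l, hl⟩ :=
    (hAfin.subset (inter_subset_inter_left _ (sdiff_subset (t := U)))).exists_encard_eq_coe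
  have hkl : k + l = n := by
    have := encard_inter_add_encard_sdiff_inter (D := cbDeriv univ α) hUA
    rw [hk, hl, hAn] at this
    exact_mod_cast this
  have hdiff : ∀ {V : Set Y} {i j : ℕ}, V ⊆ B → (V ∩ cbDeriv univ α).encard = i → i + j = n →
      ((B \ V) ∩ cbDeriv univ α).encard = j := by
    intro V i j hVB hVi hij
    have := encard_inter_add_encard_sdiff_inter (D := cbDeriv univ α) hVB
    rw [hVi, hBn, ← hij, Nat.cast_add] at this
    exact ENat.add_right_injective_of_ne_top (ENat.natCast_ne_top i) this
  rcases Nat.eq_zero_or_pos k with rfl | hkpos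
  · obtain ⟨V, hV, hVB, hUV, hVα⟩ := exists_sameCBType_of_inter_cbDeriv_eq_empty hU hB
      (encard_eq_zero.1 (by simpa using hk)) hBne
    refine ⟨V, hV, hVB, hUV, Or.inr ⟨α, l, by omega, hl, hdiff hVB (i := 0) ?_ hkl⟩⟩
    simp [hVα]
  rcases Nat.eq_zero_or_pos l with rfl | hlpos
  · obtain ⟨V, hV, hVB, hUV, hVα⟩ := exists_sameCBType_of_inter_cbDeriv_eq_empty hU' hB
      (encard_eq_zero.1 (by simpa using hl)) hBne
    refine ⟨B \ V, hB.diff hV, sdiff_subset, Or.inr ⟨α, k, by omega, hk,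
      hdiff hVB (i := 0) ?_ (by omega)⟩, ?_⟩
    · simp [hVα]
    · rwa [sdiff_sdiff_cancel_left hVB]
  · obtain ⟨V, hV, hVB, hVk⟩ := hB.exists_isClopen_encard_inter_eq hBn (k := k) (by omega)
    exact ⟨V, hV, hVB, Or.inr ⟨α, k, by omega, hk, hVk⟩,
      Or.inr ⟨α, l, by omega, hl, hdiff hVB hVk hkl⟩⟩

/-- **Mazurkiewicz–Sierpiński**: the Cantor–Bendixson type classifies countable compact Polish
spaces up to homeomorphism. -/
theorem SameCBType.nonempty_homeomorph (h : SameCBType (univ : Set X) (univ : Set Y)) :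
    Nonempty (X ≃ₜ Y) := by
  refine nonempty_homeomorph_of_clopenSplits (R := SameCBType)
    (fun A B h => ⟨h.nonempty, h.symm.nonempty⟩) clopenSplits_sameCBType ?_
    (Or.inl ⟨rfl, rfl⟩) h
  intro B A U hB hA hBA hU hUB
  obtain ⟨V, hV, hVA, h₁, h₂⟩ := clopenSplits_sameCBType B A U hB hA hBA.symm hU hUB
  exact ⟨V, hV, hVA, h₁.symm, h₂.symm⟩

end Classification

/-! ### Compact countable sets of prescribed rank. -/

section Realization

variable {E : Type*} [TopologicalSpace E]

theorem isCompact_insert_iUnion_of_tendsto_smallSets {K : ℕ → Set E} {p : E}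
    (hK : ∀ n, IsCompact (K n)) (hlim : Tendsto K atTop (𝓝 p).smallSets) :
    IsCompact (insert p (⋃ n, K n)) := by
  refine isCompact_of_finite_subcover fun {ι} U hU hcov => ?_
  obtain ⟨i₀, hi₀⟩ := mem_iUnion.1 (hcov (mem_insert _ _))
  obtain ⟨N, hN⟩ := eventually_atTop.1
    (tendsto_smallSets_iff.1 hlim _ ((hU i₀).mem_nhds hi₀))
  have hfin : IsCompact (⋃ n ∈ Finset.range N, K n) :=
    (Finset.range N).isCompact_biUnion fun n _ => hK n
  obtain ⟨t, ht⟩ := hfin.elim_finite_subcover U hU fun x hx => by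
    simp only [mem_iUnion] at hx
    obtain ⟨n, -, hx⟩ := hx
    exact hcov (mem_insert_of_mem _ (mem_iUnion.2 ⟨n, hx⟩))
  classical
  refine ⟨insert i₀ t, ?_⟩
  have hsub : U i₀ ∪ ⋃ i ∈ t, U i ⊆ ⋃ i ∈ insert i₀ t, U i := by
    simp
  refine Subset.trans ?_ hsub
  rintro x (rfl | hx)
  · exact Or.inl hi₀
  · obtain ⟨n, hn⟩ := mem_iUnion.1 hx
    rcases lt_or_ge n N with h | h
    · exact Or.inr (ht (mem_biUnion (Finset.mem_coe.2 (Finset.mem_range.2 h)) hn))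
    · exact Or.inl (hN n h hn)

/-- Near each point of a perfect set there are countable compact sets of every countable rank. -/
theorem Preperfect.exists_isCompact_countable_mem_cbDeriv [MetrizableSpace E] {P : Set E}
    (hP : Preperfect P) {α : Ordinal.{0}} (hα : α < ω₁) {p : E} (hp : p ∈ P) {U : Set E}
    (hU : U ∈ 𝓝 p) :
    ∃ K ⊆ U, IsCompact K ∧ K.Countable ∧ p ∈ cbDeriv K α := by
  induction α using WellFoundedLT.induction generalizing p U with
  | ind α ih =>
  rcases eq_or_ne α 0 with rfl | hα0
  · exact ⟨{p}, by simpa using mem_of_mem_nhds hU, isCompact_singleton, countable_singleton p,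
      by simp⟩
  have : Countable (Iio α) := countable_Iio_of_lt_omega_one hα
  have : Nonempty (Iio α) := ⟨⟨0, pos_iff_ne_zero.2 hα0⟩⟩
  obtain ⟨e, he⟩ := exists_surjective_nat (Iio α)
  obtain ⟨V, hV⟩ := (𝓝 p).exists_antitone_basis
  -- Through `Nat.unpair` each rank below `α` recurs for infinitely many `n`, hence arbitrarily
  -- close to `p`.
  have hstep : ∀ n, ∃ q ≠ p, ∃ K ⊆ V n ∩ U, IsCompact K ∧ K.Countable ∧
      q ∈ cbDeriv K (e n.unpair.1) := by
    intro n
    obtain ⟨W, hWsub, hWo, hpW⟩ := mem_nhds_iff.1 (inter_mem (hV.mem n) hU)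
    obtain ⟨q, ⟨hqW, hqP⟩, hne⟩ := accPt_iff_nhds.1 (hP p hp) W (hWo.mem_nhds hpW)
    obtain ⟨K, hKW, hK⟩ := ih (e n.unpair.1) (e n.unpair.1).2 ((e n.unpair.1).2.trans hα) hqP (hWo.mem_nhds hqW)
    exact ⟨q, hne, K, hKW.trans hWsub, hK⟩
  choose q hqp K hKsub hK hKc hq using hstep
  refine ⟨insert p (⋃ n, K n), ?_, ?_, (countable_iUnion hKc).insert p, ?_⟩
  · exact insert_subset (mem_of_mem_nhds hU) (iUnion_subset fun n => (hKsub n).trans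
      inter_subset_right)
  · refine isCompact_insert_iUnion_of_tendsto_smallSets hK ?_
    exact tendsto_smallSets_iff.2 fun W hW => (hV.eventually_subset hW).mono fun n hn =>
      ((hKsub n).trans inter_subset_left).trans hn
  · refine mem_cbDeriv.2 ⟨mem_insert _ _, fun β hβ => ?_⟩
    rw [mem_derivedSet, accPt_iff_nhds]
    intro W hW
    obtain ⟨N, hN⟩ := hV.mem_iff.1 hW
    obtain ⟨i, hi⟩ := he ⟨β, hβ⟩
    have hVW : V (Nat.pair i N) ⊆ W := (hV.antitone (Nat.right_le_pair i N)).trans hN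
    refine ⟨q (Nat.pair i N), ⟨hVW (hKsub _ (cbDeriv_subset _ _ (hq _))).1, ?_⟩, hqp _⟩
    have hqN := hq (Nat.pair i N)
    rw [Nat.unpair_pair, hi] at hqN
    exact cbDeriv_mono ((subset_iUnion K _).trans (subset_insert _ _)) _ hqN

theorem mapsTo_val_cbDeriv (A : Set E) (α : Ordinal.{0}) :
    MapsTo Subtype.val (cbDeriv (univ : Set A) α) (cbDeriv A α) :=
  mapsTo_cbDeriv (fun x _ => x.2) continuous_subtype_val.continuousOn
    Subtype.val_injective.injOn α

theorem Homeomorph.cbDeriv_nonempty {A B : Set E} (h : A ≃ₜ B) {α : Ordinal.{0}}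
    (hA : (cbDeriv A α).Nonempty) : (cbDeriv B α).Nonempty := by
  classical
  -- The values off `A` are irrelevant; `mapsTo_cbDeriv` just needs a map on all of `E`.
  let f : E → E := fun x => if hx : x ∈ A then h ⟨x, hx⟩ else x
  have hf : ∀ x (hx : x ∈ A), f x = h ⟨x, hx⟩ := fun x hx => dif_pos hx
  obtain ⟨x, hx⟩ := hA
  refine ⟨f x, mapsTo_cbDeriv (fun y hy => ?_) ?_ (fun y hy z hz hyz => ?_) α hx⟩
  · rw [hf y hy]
    exact (h _).2
  · rw [continuousOn_iff_continuous_domRestrict]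
    have : A.domRestrict f = fun y => (h y : E) := funext fun y => hf y y.2
    rw [this]
    exact continuous_subtype_val.comp h.continuous
  · rw [hf y hy, hf z hz] at hyz
    exact congrArg Subtype.val (h.injective (Subtype.val_injective hyz))

end Realization

/-! ### Counting the classes. -/

section Cardinality

universe u

variable {E : Type u} [TopologicalSpace E]

namespace CompactCountable

theorem countable (K : CompactCountable E) : Countable K.1 := K.2.2

theorem compactSpace (K : CompactCountable E) : CompactSpace K.1 :=
  isCompact_iff_compactSpace.1 K.2.1

theorem polishSpace [PolishSpace E] (K : CompactCountable E) : PolishSpace K.1 :=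
  K.2.1.isClosed.polishSpace

/-- `K` has `n` points of maximal Cantor–Bendixson rank `α`; for empty `K`, `n = 0`. -/
def HasType (K : CompactCountable E) (t : Ordinal.{0} × ℕ) : Prop :=
  (cbDeriv (univ : Set K.1) t.1).encard = t.2 ∧ (t.2 = 0 → K.1 = ∅)

theorem HasType.nonempty_homeomorph [PolishSpace E] {K L : CompactCountable E}
    {t : Ordinal.{0} × ℕ} (hK : K.HasType t) (hL : L.HasType t) : Nonempty (K.1 ≃ₜ L.1) := by
  have := K.countable
  have := L.countable
  have := K.compactSpace
  have := L.compactSpace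
  have := K.polishSpace
  have := L.polishSpace
  apply SameCBType.nonempty_homeomorph
  rcases eq_or_ne t.2 0 with h | h
  · left
    rw [univ_eq_empty_iff, univ_eq_empty_iff, isEmpty_coe_sort, isEmpty_coe_sort]
    exact ⟨hK.2 h, hL.2 h⟩
  · exact Or.inr ⟨t.1, t.2, h, by rw [univ_inter, hK.1], by rw [univ_inter, hL.1]⟩

theorem exists_hasType [PolishSpace E] (K : CompactCountable E) {γ : Ordinal.{0}} (h0 : 0 < γ)
    (hγ : cbDeriv (univ : Set K.1) γ = ∅) : ∃ t, t.1 < γ ∧ K.HasType t := by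
  have := K.compactSpace
  rcases isEmpty_or_nonempty K.1 with h | h
  · refine ⟨(0, 0), h0, ?_, fun _ => isEmpty_coe_sort.1 h⟩
    simpa using isEmpty_coe_sort.1 h
  · obtain ⟨α, hα, n, hn, h⟩ := isClosed_univ.exists_encard_inter_cbDeriv univ_nonempty hγ
    exact ⟨(α, n), hα, by rwa [univ_inter] at h, fun h0 => absurd h0 hn⟩

end CompactCountable

open CompactCountable Cardinal

theorem CompactCountableClasses.exists_injective_of_hasType [PolishSpace E] (S : Set Ordinal.{0})
    (h : ∀ K : CompactCountable E, ∃ t, t.1 ∈ S ∧ K.HasType t) :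
    ∃ f : CompactCountableClasses E → S × ℕ, Function.Injective f := by
  choose t htS ht using fun q : CompactCountableClasses E => h (Quotient.out q)
  refine ⟨fun q => (⟨(t q).1, htS q⟩, (t q).2), fun q r hqr => ?_⟩
  have heq : t q = t r := Prod.ext (congrArg (fun p => p.1.1) hqr) (congrArg (fun p => p.2) hqr)
  exact Quotient.out_equiv_out.1 ((ht q).nonempty_homeomorph (heq ▸ ht r))

theorem CompactCountableClasses.mk_le_aleph_one [PolishSpace E] :
    #(CompactCountableClasses E) ≤ aleph 1 := by
  obtain ⟨f, hf⟩ := exists_injective_of_hasType (E := E) (Iio ω₁) fun K => by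
    have := K.countable
    have := K.polishSpace
    obtain ⟨γ, hγ, hempty⟩ := (isClosed_univ (X := K.1)).exists_cbDeriv_eq_empty (to_countable _)
    -- `exists_hasType` needs a positive bound, as empty `K` gets type `(0, 0)`; stage `0` is
    -- replaced by `1`.
    rcases eq_or_ne γ 0 with rfl | h0
    · obtain ⟨t, ht, h⟩ := K.exists_hasType (γ := 1) zero_lt_one (subset_empty_iff.1
        (hempty ▸ cbDeriv_antitone _ zero_le_one))
      exact ⟨t, ht.trans (Ordinal.one_lt_omega0.trans Ordinal.omega0_lt_omega_one), h⟩
    · obtain ⟨t, ht, h⟩ := K.exists_hasType (pos_iff_ne_zero.2 h0) hempty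
      exact ⟨t, ht.trans hγ, h⟩
  have := lift_mk_le_lift_mk_of_injective hf
  rw [mk_prod, mk_Iio_omega_one] at this
  simpa using this

theorem CompactCountableClasses.countable [PolishSpace E] [Countable E] :
    Countable (CompactCountableClasses E) := by
  obtain ⟨γ, hγ, hempty⟩ := (isClosed_univ (X := E)).exists_cbDeriv_eq_empty (to_countable _)
  have h1 : γ + 1 < ω₁ := (isSuccLimit_omega 1).add_one_lt hγ
  obtain ⟨f, hf⟩ := exists_injective_of_hasType (E := E) (Iio (γ + 1)) fun K => by
    refine K.exists_hasType (by simp) (eq_empty_iff_forall_notMem.2 fun x hx => ?_)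
    have := cbDeriv_mono (subset_univ _) _ (mapsTo_val_cbDeriv _ _
      (cbDeriv_antitone _ (le_add_of_nonneg_right zero_le_one) hx))
    rwa [hempty] at this
  have : Countable (Iio (γ + 1)) := countable_Iio_of_lt_omega_one h1
  exact hf.countable

/-- If the classes were countable, the vanishing stages of representatives would have supremum below
`ω₁`. A set whose derivative at that supremum is nonempty is homeomorphic to none of them. -/
theorem CompactCountableClasses.uncountable [PolishSpace E] [Uncountable E] :
    Uncountable (CompactCountableClasses E) := by
  by_contra hc
  rw [not_uncountable_iff] at hc
  obtain ⟨P, hP, ⟨p, hp⟩, -⟩ := exists_perfect_nonempty_of_isClosed_of_not_countable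
    (isClosed_univ (X := E)) (by simp [countable_univ_iff])
  choose γ hγ hempty using fun q : CompactCountableClasses E =>
    (Quotient.out q).2.1.isClosed.exists_cbDeriv_eq_empty (Quotient.out q).2.2
  have hsup : ⨆ q, γ q < ω₁ := Ordinal.iSup_lt_omega_one hγ
  obtain ⟨K, -, hK, hKc, hpK⟩ := hP.acc.exists_isCompact_countable_mem_cbDeriv hsup hp univ_mem
  let q : CompactCountableClasses E := Quotient.mk _ ⟨K, hK, hKc⟩
  obtain ⟨h⟩ : Nonempty ((⟨K, hK, hKc⟩ : CompactCountable E).1 ≃ₜ (Quotient.out q).1) :=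
    Quotient.exact (Quotient.out_eq q).symm
  have hle : γ q ≤ ⨆ q, γ q := Ordinal.le_iSup γ q
  have := h.cbDeriv_nonempty ⟨p, cbDeriv_antitone K hle hpK⟩
  exact this.ne_empty (hempty q)

/-- The class of a finite set. -/
def CompactCountable.ofFinset (s : Finset E) : CompactCountable E :=
  ⟨s, s.finite_toSet.isCompact, s.countable_toSet⟩

theorem CompactCountableClasses.infinite [Infinite E] : Infinite (CompactCountableClasses E) := by
  choose s hs using fun n : ℕ => Infinite.exists_subset_card_eq E n
  refine Infinite.of_injective (fun n => (Quotient.mk _ (ofFinset (s n)) :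
    CompactCountableClasses E)) fun m n hmn => ?_
  obtain ⟨h⟩ : Nonempty (((s m : Finset E) : Set E) ≃ₜ ((s n : Finset E) : Set E)) :=
    Quotient.exact hmn
  have := Nat.card_congr h.toEquiv
  simpa [hs] using this

theorem CompactCountableClasses.mk_of_finite [T2Space E] [Finite E] :
    #(CompactCountableClasses E) = #E + 1 := by
  classical
  have := Fintype.ofFinite E
  let f : CompactCountableClasses E → Fin (Fintype.card E + 1) :=
    Quotient.lift (fun K => ⟨K.1.ncard, Nat.lt_succ_of_le
      ((ncard_le_card _).trans_eq Nat.card_eq_fintype_card)⟩)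
      fun K L ⟨h⟩ => Fin.ext (Nat.card_congr h.toEquiv)
  have hf : Function.Bijective f := by
    constructor
    · rintro ⟨K⟩ ⟨L⟩ h
      refine Quotient.sound ?_
      have hKL : Nat.card K.1 = Nat.card L.1 := congrArg Fin.val h
      exact ⟨(Finite.equivFinOfCardEq hKL |>.trans (Finite.equivFin L.1).symm).toHomeomorphOfDiscrete⟩
    · intro k
      obtain ⟨s, -, hs⟩ := Finset.exists_subset_card_eq (s := (Finset.univ : Finset E))
        (n := k.1) (Nat.lt_succ_iff.1 k.2)
      exact ⟨Quotient.mk _ (ofFinset s), Fin.ext ((ncard_coe_finset s).trans hs)⟩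
  have := Finite.of_injective f hf.1
  rw [← Nat.cast_card, Nat.card_congr (Equiv.ofBijective f hf)]
  simp

end Cardinality

theorem mainTheorem1 (E : Type*) [TopologicalSpace E] [PolishSpace E] :
    (Finite E → Cardinal.mk (CompactCountableClasses E) = Cardinal.mk E + 1) ∧
    (Countable E → Infinite E →
      Cardinal.mk (CompactCountableClasses E) = Cardinal.mk E ∧
        Cardinal.mk E = Cardinal.aleph0) ∧
    (Uncountable E → Cardinal.mk (CompactCountableClasses E) = Cardinal.aleph 1) := by
  refine ⟨fun _ => CompactCountableClasses.mk_of_finite, fun _ _ => ?_, fun _ => ?_⟩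
  · have := CompactCountableClasses.countable (E := E)
    have := CompactCountableClasses.infinite (E := E)
    exact ⟨by rw [Cardinal.mk_eq_aleph0, Cardinal.mk_eq_aleph0], Cardinal.mk_eq_aleph0 E⟩
  · have := CompactCountableClasses.uncountable (E := E)
    exact CompactCountableClasses.mk_le_aleph_one.antisymm
      (Cardinal.aleph_one_le_iff.2 (Cardinal.aleph0_lt_mk_iff.2 this))
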